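/- Let $d\ge 1$, $L>0$, $\sigma>0$, $\lambda\ge 0$, and $\mathcal Z=\mathbb R^d\times\{-1,+1\}$, with $\mathcal M(\mathcal Z)$ the set of all probability measures on $\mathcal Z$. For $P,Q\in\mathcal M(\mathcal Z)$ put $$\mathcal W_\lambda(P,Q)=\inf_{\pi}\ \mathbb E_{\pi}\big[\|X-X'\|_2+\lambda\,\mathbb 1\{y\ne y'\}\big],$$ the infimum being over all couplings $\pi$ of $P$ and $Q$. Let $\mathcal G_g(L)$ be the set of laws $P_{\mu}$ ($\mu\in\mathbb R^d$, $\|\mu\|_2\ge L$) of $(X,y)$ with $y$ uniform on $\{-1,+1\}$ and $X\mid y\sim\mathcal N(y\mu,\sigma^2 I)$. The linear classifiers are indexed by unit vectors $\omega\in\mathbb R^d$, with risk $R(P,\omega)=P\big(y\langle\omega,X\rangle\le 0\big)$ and with risk up to a swap of the two labels $\tilde R(P,\omega)=\min\{P(y\langle\omega,X\rangle\le 0),\,P(-y\langle\omega,X\rangle\le 0)\}$. For a risk $\rho\in\{R,\tilde R\}$ and $\eta\ge 0$ define the constrained and the unconstrained compatibility functions $$g^{\mathrm C}_{\lambda,\rho}(\eta)=\sup_{P_0\in\mathcal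 G_g(L)}\ \inf_{\|\omega\|_2=1}\ \sup_{\substack{P\in\mathcal G_g(L)\\ \mathcal W_\lambda(P,P_0)\le\eta}}\rho(P,\omega),\qquad g^{\mathrm{UC}}_{\lambda,\rho}(\eta)=\sup_{P_0\in\mathcal G_g(L)}\ \inf_{\|\omega\|_2=1}\ \sup_{\substack{P\in\mathcal M(\mathcal Z)\\ \mathcal W_\lambda(P,P_0)\le\eta}}\rho(P,\omega).$$ Then: 1. $g^{\mathrm C}_{\lambda,\tilde R}(\eta)\le e^{-L^2/(18\sigma^2)}$ for all $\eta\in[0,L/3]$. 2. There is an absolute constant $c>0$ (independent of $d,L,\sigma,\lambda,\eta$) such that for both $\rho=R$ and $\rho=\tilde R$ and all $\eta\ge 0$, $$g^{\mathrm{UC}}_{\lambda,\rho}(\eta)\ \ge\ c\,\min\Big\{1,\ \tfrac{\sigma}{\sigma+L}\,e^{-L^2/(2\sigma^2)}+\sqrt{\tfrac{\eta}{\sigma}\,e^{-L^2/(2\sigma^2)}}\Big\}.$$ 3. In particular, there is a constant $c_{L,\sigma}>0$ depending only on $L$ and $\sigma$ such that for both $\rho=R$ and $\rho=\tilde R$ and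 all $\eta\ge0$, $$g^{\mathrm{UC}}_{\lambda,\rho}(\eta)\ \ge\ c_{L,\sigma}\,\min\Big\{1,\ e^{-L^2/(2\sigma^2)}+\sqrt{\eta\, e^{-L^2/(2\sigma^2)}}\Big\}.$$ -/

import Mathlib

open MeasureTheory ProbabilityTheory
open scoped ENNReal NNReal

noncomputable section

namespace GDA

/-- Labeled data `(X, y)` with `X ∈ ℝ^d` (Euclidean norm) and `y ∈ {-1, +1}`; the units of `ℤ`
are exactly `-1` and `1`. -/
abbrev Data (d : ℕ) : Type := EuclideanSpace ℝ (Fin d) × ℤˣ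

/-- The label `y ∈ {-1, +1}` as a real number. -/
def labelVal (y : ℤˣ) : ℝ := ((y : ℤ) : ℝ)

/-- Couplings of two probability measures on the data space. -/
def couplings {d : ℕ} (P Q : ProbabilityMeasure (Data d)) : Set (Measure (Data d × Data d)) :=
  {π | π.fst = (P : Measure (Data d)) ∧ π.snd = (Q : Measure (Data d))}

/-- The transport cost `‖X - X'‖₂ + lam * 1{y ≠ y'}`. -/
def transportCost {d : ℕ} (lam : ℝ≥0) (z z' : Data d) : ℝ≥0∞ :=
  ENNReal.ofReal ‖z.1 - z'.1‖ + if z.2 ≠ z'.2 then (lam : ℝ≥0∞) else 0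

/-- The label-weighted Wasserstein distance of order one with Euclidean ground norm. -/
def wasserstein {d : ℕ} (lam : ℝ≥0) (P Q : ProbabilityMeasure (Data d)) : ℝ≥0∞ :=
  ⨅ π ∈ couplings P Q, ∫⁻ w, transportCost lam w.1 w.2 ∂π

/-- The Wasserstein ball of radius `η` around `P₀`, restricted to the class `G`. -/
def restrictedBall {d : ℕ} (lam : ℝ≥0) (G : Set (ProbabilityMeasure (Data d))) (η : ℝ)
    (P₀ : ProbabilityMeasure (Data d)) : Set (ProbabilityMeasure (Data d)) :=
  {P | P ∈ G ∧ wasserstein lam P P₀ ≤ ENNReal.ofReal η}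

/-- The 0-1 loss `1{y ⟨ω, X⟩ ≤ 0}` of the linear classifier with normal vector `ω`. -/
def zeroOneLoss {d : ℕ} (ω x : EuclideanSpace ℝ (Fin d)) (y : ℤˣ) : ℝ≥0∞ :=
  if labelVal y * inner ℝ ω x ≤ 0 then 1 else 0

/-- The expected 0-1 loss of the linear classifier `ω` under `P`. -/
def risk {d : ℕ} (P : ProbabilityMeasure (Data d)) (ω : EuclideanSpace ℝ (Fin d)) : ℝ≥0∞ :=
  ∫⁻ z, zeroOneLoss ω z.1 z.2 ∂(P : Measure (Data d))

/-- The expected 0-1 loss up to a global swap of the two labels. -/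
def swapRisk {d : ℕ} (P : ProbabilityMeasure (Data d)) (ω : EuclideanSpace ℝ (Fin d)) : ℝ≥0∞ :=
  min (∫⁻ z, zeroOneLoss ω z.1 z.2 ∂(P : Measure (Data d)))
    (∫⁻ z, zeroOneLoss ω z.1 (-z.2) ∂(P : Measure (Data d)))

/-- For a risk functional `R`, the least `g(η)` such that `g(η)` is at least
`inf_ω sup_P R(P, ω)` for every center `P₀ ∈ centers`, where `ω` runs through the unit vectors
(the linear classifiers) and `P` through the `G`-restricted ball of radius `η` around `P₀`. -/
def compatibility {d : ℕ}
    (R : ProbabilityMeasure (Data d) → EuclideanSpace ℝ (Fin d) → ℝ≥0∞) (lam : ℝ≥0)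
    (centers G : Set (ProbabilityMeasure (Data d))) (η : ℝ) : ℝ≥0∞ :=
  ⨆ P₀ ∈ centers, ⨅ ω ∈ Metric.sphere (0 : EuclideanSpace ℝ (Fin d)) 1,
    ⨆ P ∈ restrictedBall lam G η P₀, R P ω

/-- The law of `(X, y)` with `y` uniform on `{-1, +1}` and `X | y ∼ N(y μ, σ² I)`. -/
def gaussianModel {d : ℕ} (σ : ℝ) (μ : EuclideanSpace ℝ (Fin d)) : Measure (Data d) :=
  ∑ y : ℤˣ, (2⁻¹ : ℝ≥0∞) •
    (multivariateGaussian (labelVal y • μ) (σ ^ 2 • (1 : Matrix (Fin d) (Fin d) ℝ))).prod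
      (Measure.dirac y)

/-- The Gaussian manifold: all Gaussian models with `‖μ‖₂ ≥ L`. -/
def gaussianManifold (d : ℕ) (σ L : ℝ) : Set (ProbabilityMeasure (Data d)) :=
  {P | ∃ μ : EuclideanSpace ℝ (Fin d), L ≤ ‖μ‖ ∧ (P : Measure (Data d)) = gaussianModel σ μ}

/-- The manifold-constrained compatibility function. -/
def constrainedCompatibility {d : ℕ}
    (R : ProbabilityMeasure (Data d) → EuclideanSpace ℝ (Fin d) → ℝ≥0∞)
    (lam : ℝ≥0) (σ L η : ℝ) : ℝ≥0∞ :=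
  compatibility R lam (gaussianManifold d σ L) (gaussianManifold d σ L) η

/-- The unconstrained compatibility function: the centers are still Gaussian models, but the
ball contains all probability measures. -/
def unconstrainedCompatibility {d : ℕ}
    (R : ProbabilityMeasure (Data d) → EuclideanSpace ℝ (Fin d) → ℝ≥0∞)
    (lam : ℝ≥0) (σ L η : ℝ) : ℝ≥0∞ :=
  compatibility R lam (gaussianManifold d σ L) Set.univ η

end GDA

end

namespace GDA

/-! Under `gaussianModel σ μ` and a unit vector `ω`, the margin `y⟨ω, X⟩` has law N(a, σ²) with a =
⟨ω, μ⟩, so everything reduces to one-dimensional Gaussians.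

Upper bound: the mean of |⟨ω, X⟩| ignores labels and is 1-Lipschitz for the Wasserstein distance
(`lintegral_abs_margin_le`). With `ω` the direction of the center's mean, it is at least L at the
center and at most √(a² + σ²) at another model. Within radius L/3 this keeps |a| away from 0 unless
L is of order σ, and a Chernoff bound finishes (`min_gaussianReal_real_le_exp`).

Lower bound: take ‖μ‖ = L, any `ω`, and a ≥ 0 after replacing `ω` by -`ω`. Projecting the points
with margin in (0, t] onto the decision boundary keeps labels, so `lam` plays no role, and costs at
most t·N(0, t]. Boundary points are errors for both labelings, since the loss counts margin 0. On
[0, 2a] the density is at least p = exp(-L²/(2σ²))/(√(2π)σ), so spending t·N(0, t] = η gives N(0,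
t]² ≥ ηp: this is the square root term. The mass already below 0 gives the Mills term
(`exists_threshold`). -/

/-! ### One-dimensional Gaussian estimates -/

lemma gaussianReal_real_Ioc (a : ℝ) {v : ℝ≥0} (hv : v ≠ 0) {x y : ℝ} (hxy : x ≤ y) :
    (gaussianReal a v).real (Set.Ioc x y) = ∫ s in x..y, gaussianPDFReal a v s := by
  rw [measureReal_def, gaussianReal_apply_eq_integral a hv, ENNReal.toReal_ofReal
    (integral_nonneg fun s => gaussianPDFReal_nonneg a v s), intervalIntegral.integral_of_le hxy]

lemma mul_le_gaussianReal_real_Ioc (a : ℝ) {v : ℝ≥0} (hv : v ≠ 0) {x y m : ℝ} (hxy : x ≤ y)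
    (hm : ∀ s ∈ Set.Icc x y, m ≤ gaussianPDFReal a v s) :
    (y - x) * m ≤ (gaussianReal a v).real (Set.Ioc x y) := by
  rw [gaussianReal_real_Ioc a hv hxy]
  have := intervalIntegral.integral_mono_on (μ := volume) hxy (f := fun _ => m)
    (by simp) ((integrable_gaussianPDFReal a v).intervalIntegrable) hm
  simpa using this

lemma continuousOn_gaussianReal_real_Ioc (a : ℝ) {v : ℝ≥0} (hv : v ≠ 0) (r : ℝ) :
    ContinuousOn (fun t => (gaussianReal a v).real (Set.Ioc 0 t)) (Set.Icc 0 r) := by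
  have hc : Continuous fun t => ∫ s in (0 : ℝ)..t, gaussianPDFReal a v s :=
    intervalIntegral.continuous_primitive
      (fun _ _ => (integrable_gaussianPDFReal a v).intervalIntegrable) 0
  exact hc.continuousOn.congr fun t ht => gaussianReal_real_Ioc a hv ht.1

/-- Reflection about the mean exchanges the two half-lines, which together cover the line. -/
lemma half_le_gaussianReal_real_Iic_Ici (a : ℝ) (v : ℝ≥0) :
    1 / 2 ≤ (gaussianReal a v).real (Set.Iic a) ∧ 1 / 2 ≤ (gaussianReal a v).real (Set.Ici a) := by
  have heq : (gaussianReal a v).real (Set.Iic a) = (gaussianReal a v).real (Set.Ici a) := by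
    have h := gaussianReal_map_const_sub (μ := a) (v := v) (2 * a)
    rw [show 2 * a - a = a by ring] at h
    conv_lhs => rw [← h]
    rw [map_measureReal_apply (by fun_prop) measurableSet_Iic]
    congr 1
    ext x
    simp only [Set.mem_preimage, Set.mem_Iic, Set.mem_Ici]
    constructor <;> intro h <;> linarith
  have hsum : 1 ≤ (gaussianReal a v).real (Set.Iic a) + (gaussianReal a v).real (Set.Ici a) := by
    have := measureReal_union_le (μ := gaussianReal a v) (Set.Iic a) (Set.Ici a)
    rwa [Set.Iic_union_Ici, probReal_univ] at this
  constructor <;> linarith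

lemma gaussianReal_real_Iic_le {a : ℝ} (ha : 0 ≤ a) (v : ℝ≥0) :
    (gaussianReal a v).real (Set.Iic 0) ≤ Real.exp (-a ^ 2 / (2 * v)) := by
  rcases eq_or_ne v 0 with rfl | hv
  -- For `v = 0` the quotient is 0 by convention, so the bound is 1.
  · simp
  -- Chernoff bound at the optimal exponent -a/v.
  have h := measure_le_le_exp_mul_mgf (μ := gaussianReal a v) (X := id) (t := -a / v) 0
    (div_nonpos_of_nonpos_of_nonneg (by linarith) v.2) (by
      simpa using integrable_exp_mul_gaussianReal (μ := a) (v := v) (-a / v))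
  rw [mgf_id_gaussianReal] at h
  have hv' : (v : ℝ) ≠ 0 := by exact_mod_cast hv
  calc _ ≤ _ := h
    _ = _ := by
      rw [mul_zero, Real.exp_zero, one_mul]
      beta_reduce
      congr 1
      field_simp
      ring

lemma gaussianReal_real_Ici_le {a : ℝ} (ha : a ≤ 0) (v : ℝ≥0) :
    (gaussianReal a v).real (Set.Ici 0) ≤ Real.exp (-a ^ 2 / (2 * v)) := by
  have h := gaussianReal_real_Iic_le (neg_nonneg.mpr ha) v
  rw [← gaussianReal_map_neg, map_measureReal_apply (by fun_prop) measurableSet_Iic] at h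
  simpa [Set.preimage, Set.Ici] using h

lemma min_gaussianReal_real_Iic_Ici_le_half (a : ℝ) {v : ℝ≥0} (hv : v ≠ 0) :
    min ((gaussianReal a v).real (Set.Iic 0)) ((gaussianReal a v).real (Set.Ici 0)) ≤ 1 / 2 := by
  have := nullSingletonClass_gaussianReal (μ := a) hv
  have h := measureReal_add_measureReal_compl (μ := gaussianReal a v)
    (measurableSet_Iic (a := (0 : ℝ)))
  rw [Set.compl_Iic, probReal_univ, ← measureReal_congr (Ioi_ae_eq_Ici).symm] at h
  rcases le_total ((gaussianReal a v).real (Set.Iic 0)) (1 / 2) with h1 | h1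
  · exact min_le_of_left_le h1
  · exact min_le_of_right_le (by linarith)

/-- The variance of |x| is nonnegative, and the second moment is a² + v. -/
lemma integral_abs_gaussianReal_le (a : ℝ) (v : ℝ≥0) :
    ∫ x, |x| ∂gaussianReal a v ≤ √(a ^ 2 + v) := by
  have hm : MemLp (fun x : ℝ => |x|) 2 (gaussianReal a v) := by
    simpa using (memLp_id_gaussianReal (μ := a) (v := v) 2).norm
  have h1 := variance_nonneg (fun x : ℝ => |x|) (gaussianReal a v)
  have h2 := variance_fun_id_gaussianReal (μ := a) (v := v)
  rw [variance_eq_sub hm] at h1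
  rw [variance_eq_sub (X := fun x => x) (memLp_id_gaussianReal (μ := a) (v := v) 2)] at h2
  simp only [Pi.pow_apply, sq_abs, integral_id_gaussianReal] at h1 h2
  apply Real.le_sqrt_of_sq_le
  linarith

lemma le_integral_abs_gaussianReal (a : ℝ) (v : ℝ≥0) : a ≤ ∫ x, |x| ∂gaussianReal a v := by
  calc a = ∫ x, x ∂gaussianReal a v := integral_id_gaussianReal.symm
    _ ≤ _ := (le_abs_self _).trans abs_integral_le_integral_abs

/-- A lower bound for the Gaussian mass just below the origin, of the order of the Mills ratio. -/
lemma mills_le_gaussianReal_real_Ioc {a L σ : ℝ} (ha : 0 ≤ a) (haL : a ≤ L) (hσ : 0 < σ) :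
    Real.exp (-(3 / 2)) / √(2 * Real.pi) * (σ / (σ + L) * Real.exp (-L ^ 2 / (2 * σ ^ 2))) ≤
      (gaussianReal a (σ ^ 2).toNNReal).real (Set.Ioc (-(σ ^ 2 / (σ + L))) 0) := by
  have hL : 0 ≤ L := ha.trans haL
  have hv : (σ ^ 2).toNNReal ≠ 0 := by positivity
  have hu : 0 ≤ σ ^ 2 / (σ + L) := by positivity
  refine le_trans (le_of_eq ?_) (mul_le_gaussianReal_real_Ioc a hv (neg_nonpos.mpr hu)
    (m := (√(2 * Real.pi) * σ)⁻¹ * (Real.exp (-(3 / 2)) * Real.exp (-L ^ 2 / (2 * σ ^ 2)))) ?_)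
  · field_simp
    ring
  · intro s hs
    rw [gaussianPDFReal, Real.coe_toNNReal _ (sq_nonneg σ), Real.sqrt_mul (x := 2 * Real.pi) (by positivity),
      Real.sqrt_sq hσ.le, ← Real.exp_add]
    gcongr
    have h1 : (s - a) ^ 2 ≤ (L + σ ^ 2 / (σ + L)) ^ 2 := by
      apply sq_le_sq'
      · linarith [hs.1]
      · linarith [hs.2]
    -- The width u = σ²/(σ + L) satisfies both Lu ≤ σ² and u ≤ σ; the resulting 3σ² is the source of
    -- the factor exp(-3/2).
    have h2 : (L + σ ^ 2 / (σ + L)) ^ 2 ≤ L ^ 2 + 3 * σ ^ 2 := by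
      have e1 : L * (σ ^ 2 / (σ + L)) ≤ σ ^ 2 := by
        rw [mul_div_assoc', div_le_iff₀ (by positivity)]
        nlinarith [mul_nonneg (sq_nonneg σ) hσ.le]
      have e2 : σ ^ 2 / (σ + L) ≤ σ := by
        rw [div_le_iff₀ (by positivity)]
        nlinarith
      nlinarith [pow_le_pow_left₀ hu e2 2]
    have h3 : -(3 / 2) + -L ^ 2 / (2 * σ ^ 2) = -(L ^ 2 + 3 * σ ^ 2) / (2 * σ ^ 2) := by
      field_simp
      ring
    rw [h3]
    gcongr
    linarith

lemma mul_pdf_le_gaussianReal_real_Ioc {a L σ t : ℝ} (haL : a ≤ L) (hσ : 0 < σ)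
    (ht : t ∈ Set.Icc 0 (2 * a)) :
    t * ((√(2 * Real.pi) * σ)⁻¹ * Real.exp (-L ^ 2 / (2 * σ ^ 2))) ≤
      (gaussianReal a (σ ^ 2).toNNReal).real (Set.Ioc 0 t) := by
  have hv : (σ ^ 2).toNNReal ≠ 0 := by positivity
  have := mul_le_gaussianReal_real_Ioc a hv ht.1
    (m := (√(2 * Real.pi) * σ)⁻¹ * Real.exp (-L ^ 2 / (2 * σ ^ 2))) (by
    intro s hs
    rw [gaussianPDFReal, Real.coe_toNNReal _ (sq_nonneg σ), Real.sqrt_mul (x := 2 * Real.pi) (by positivity),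
      Real.sqrt_sq hσ.le]
    have h : (s - a) ^ 2 ≤ L ^ 2 := by
      apply sq_le_sq'
      · linarith [hs.1]
      · linarith [hs.2, ht.2]
    gcongr ?_ * Real.exp (-?_ / _))
  simpa using this

/-- The threshold `t` up to which the mass of a Gaussian margin is pushed to the origin: the
transport costs at most `η`, and a large amount of mass lies below `t`. -/
lemma exists_threshold {a L σ η : ℝ} (ha : 0 ≤ a) (haL : a ≤ L) (hσ : 0 < σ) (hη : 0 ≤ η) :
    ∃ t, 0 ≤ t ∧ t * (gaussianReal a (σ ^ 2).toNNReal).real (Set.Ioc 0 t) ≤ η ∧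
      Real.exp (-(3 / 2)) / √(2 * Real.pi) *
        min 1 (σ / (σ + L) * Real.exp (-L ^ 2 / (2 * σ ^ 2)) +
          √(η / σ * Real.exp (-L ^ 2 / (2 * σ ^ 2)))) ≤
      (gaussianReal a (σ ^ 2).toNNReal).real (Set.Iic t) := by
  have hv : (σ ^ 2).toNNReal ≠ 0 := by positivity
  set N := gaussianReal a (σ ^ 2).toNNReal
  set k := Real.exp (-(3 / 2)) / √(2 * Real.pi) with hk
  have hk0 : 0 < k := by positivity
  have hpi : 2 ≤ √(2 * Real.pi) := by
    apply Real.le_sqrt_of_sq_le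
    nlinarith [Real.pi_gt_three]
  have hk1 : k ≤ (√(2 * Real.pi))⁻¹ := by
    rw [hk, div_eq_mul_inv]
    exact mul_le_of_le_one_left (by positivity) (Real.exp_le_one_iff.mpr (by norm_num))
  have hk2 : k ≤ 1 / 2 := hk1.trans (by rw [one_div]; gcongr)
  rcases le_or_gt (2 * a * N.real (Set.Ioc 0 (2 * a))) η with h | h
  -- The budget pays for all of (0, 2a], so at least the half of the mass below the mean is reached.
  · refine ⟨2 * a, by positivity, h, ?_⟩
    calc _ ≤ k * 1 := by gcongr; exact min_le_left _ _
      _ ≤ 1 / 2 := by linarith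
      _ ≤ N.real (Set.Iic a) := (half_le_gaussianReal_real_Iic_Ici _ _).1
      _ ≤ _ := measureReal_mono (Set.Iic_subset_Iic.mpr (by linarith))
  -- Otherwise the intermediate value theorem gives a `t` that spends the budget exactly.
  · have hcont : ContinuousOn (fun t => t * N.real (Set.Ioc 0 t)) (Set.Icc 0 (2 * a)) :=
      continuousOn_id.mul (continuousOn_gaussianReal_real_Ioc a hv _)
    obtain ⟨t, ht, hte⟩ := intermediate_value_Icc (by positivity) hcont
      (show η ∈ _ from ⟨by simpa using hη, h.le⟩)
    refine ⟨t, ht.1, hte.le, ?_⟩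
    have hp := mul_pdf_le_gaussianReal_real_Ioc haL hσ ht
    have hp0 : 0 ≤ N.real (Set.Ioc 0 t) := measureReal_nonneg
    have hsq : k * √(η / σ * Real.exp (-L ^ 2 / (2 * σ ^ 2))) ≤ N.real (Set.Ioc 0 t) := by
      apply le_of_sq_le_sq _ hp0
      rw [mul_pow, Real.sq_sqrt (by positivity)]
      have hk3 : k ^ 2 ≤ (√(2 * Real.pi))⁻¹ := by nlinarith
      calc _ ≤ (√(2 * Real.pi))⁻¹ * (η / σ * Real.exp (-L ^ 2 / (2 * σ ^ 2))) := by gcongr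
        _ = N.real (Set.Ioc 0 t) *
            (t * ((√(2 * Real.pi) * σ)⁻¹ * Real.exp (-L ^ 2 / (2 * σ ^ 2)))) := by
          rw [← hte]
          field_simp
        _ ≤ N.real (Set.Ioc 0 t) * N.real (Set.Ioc 0 t) := by gcongr
        _ = _ := by ring
    calc _ ≤ k * (σ / (σ + L) * Real.exp (-L ^ 2 / (2 * σ ^ 2)) +
          √(η / σ * Real.exp (-L ^ 2 / (2 * σ ^ 2)))) := by gcongr; exact min_le_right _ _
      _ ≤ N.real (Set.Ioc (-(σ ^ 2 / (σ + L))) 0) + N.real (Set.Ioc 0 t) := by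
          rw [mul_add]
          exact add_le_add (mills_le_gaussianReal_real_Ioc ha haL hσ) hsq
      _ = N.real (Set.Ioc (-(σ ^ 2 / (σ + L))) 0 ∪ Set.Ioc 0 t) := by
          rw [measureReal_union _ measurableSet_Ioc]
          exact Set.Ioc_disjoint_Ioc_of_le le_rfl
      _ ≤ _ := measureReal_mono (Set.union_subset
          (fun s hs => hs.2.trans ht.1) (fun s hs => hs.2))

/-! ### Margins, their Gaussian law, and the risks -/

variable {d : ℕ}

lemma measurable_labelVal : Measurable labelVal :=
  measurable_from_top.comp (comap_measurable (Units.val (α := ℤ)))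

lemma labelVal_neg (y : ℤˣ) : labelVal (-y) = -labelVal y := by simp [labelVal]

lemma abs_labelVal (y : ℤˣ) : |labelVal y| = 1 := by
  rcases Int.units_eq_one_or y with rfl | rfl <;> simp [labelVal]

lemma labelVal_mul_self (y : ℤˣ) : labelVal y * labelVal y = 1 := by
  rcases Int.units_eq_one_or y with rfl | rfl <;> simp [labelVal]

/-- The margin `y ⟨ω, X⟩` of the linear classifier `ω`. -/
noncomputable def margin (ω : EuclideanSpace ℝ (Fin d)) (z : Data d) : ℝ := labelVal z.2 * inner ℝ ω z.1

lemma measurable_margin (ω : EuclideanSpace ℝ (Fin d)) : Measurable (margin ω) :=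
  (measurable_labelVal.comp measurable_snd).mul
    ((innerSL ℝ ω).continuous.measurable.comp measurable_fst)

lemma abs_margin (ω : EuclideanSpace ℝ (Fin d)) (z : Data d) : |margin ω z| = |inner ℝ ω z.1| := by
  rw [margin, abs_mul, abs_labelVal, one_mul]

lemma map_inner_multivariateGaussian (m ω : EuclideanSpace ℝ (Fin d)) (hω : ‖ω‖ = 1) (σ : ℝ) :
    (multivariateGaussian m (σ ^ 2 • (1 : Matrix (Fin d) (Fin d) ℝ))).map (innerSL ℝ ω) =
      gaussianReal (inner ℝ ω m) (σ ^ 2).toNNReal := by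
  have hS : (σ ^ 2 • (1 : Matrix (Fin d) (Fin d) ℝ)).PosSemidef :=
    Matrix.PosSemidef.one.smul (sq_nonneg σ)
  rw [IsGaussian.map_eq_gaussianReal, ContinuousLinearMap.integral_comp_id_comm
    (IsGaussian.integrable_id), integral_id_multivariateGaussian, innerSL_apply_apply]
  congr 2
  have h := covarianceBilin_self (μ := multivariateGaussian m
    (σ ^ 2 • (1 : Matrix (Fin d) (Fin d) ℝ))) IsGaussian.memLp_two_id ω
  rw [covarianceBilin_multivariateGaussian hS] at h
  refine h.symm.trans ?_
  rw [Matrix.smul_mulVec, Matrix.one_mulVec, dotProduct_smul, smul_eq_mul]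
  have h1 : ω.ofLp ⬝ᵥ ω.ofLp = 1 := by
    have := EuclideanSpace.real_norm_sq_eq ω
    rw [hω] at this
    simp only [dotProduct, ← sq]
    linarith
  rw [h1, mul_one]

lemma map_margin_gaussianModel (μ ω : EuclideanSpace ℝ (Fin d)) (hω : ‖ω‖ = 1) (σ : ℝ) :
    (gaussianModel σ μ).map (margin ω) = gaussianReal (inner ℝ ω μ) (σ ^ 2).toNNReal := by
  have key (y : ℤˣ) : ((multivariateGaussian (labelVal y • μ)
      (σ ^ 2 • (1 : Matrix (Fin d) (Fin d) ℝ))).prod (Measure.dirac y)).map (margin ω) =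
      gaussianReal (inner ℝ ω μ) (σ ^ 2).toNNReal := by
    rw [Measure.prod_dirac, Measure.map_map (measurable_margin ω) (by fun_prop)]
    have hc : margin ω ∘ (fun x => (x, y)) = (fun s => labelVal y * s) ∘ innerSL ℝ ω := by
      ext x; simp [margin]
    rw [hc, ← Measure.map_map (by fun_prop) (by fun_prop), map_inner_multivariateGaussian _ _ hω,
      gaussianReal_map_const_mul, real_inner_smul_right, ← mul_assoc, labelVal_mul_self, one_mul]
    congr 1
    ext
    simp [sq, labelVal_mul_self]
  rw [gaussianModel, Measure.map_finset_sum (measurable_margin ω).aemeasurable]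
  simp_rw [Measure.map_smul, key]
  rw [Finset.sum_const, Finset.card_univ, Fintype.card_units_int, ← Nat.cast_smul_eq_nsmul ℝ≥0∞,
    smul_smul]
  simp [ENNReal.mul_inv_cancel]

instance isProbabilityMeasure_gaussianModel (σ : ℝ) (μ : EuclideanSpace ℝ (Fin d)) :
    IsProbabilityMeasure (gaussianModel σ μ) := by
  constructor
  simp [gaussianModel, ENNReal.inv_two_add_inv_two]

lemma lintegral_zeroOneLoss (P : Measure (Data d)) (ω : EuclideanSpace ℝ (Fin d)) :
    ∫⁻ z, zeroOneLoss ω z.1 z.2 ∂P = P.map (margin ω) (Set.Iic 0) := by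
  rw [Measure.map_apply (measurable_margin ω) measurableSet_Iic,
    ← lintegral_indicator_one (measurable_margin ω measurableSet_Iic)]
  rfl

lemma lintegral_zeroOneLoss_neg (P : Measure (Data d)) (ω : EuclideanSpace ℝ (Fin d)) :
    ∫⁻ z, zeroOneLoss ω z.1 (-z.2) ∂P = P.map (margin ω) (Set.Ici 0) := by
  rw [Measure.map_apply (measurable_margin ω) measurableSet_Ici,
    ← lintegral_indicator_one (measurable_margin ω measurableSet_Ici)]
  refine lintegral_congr fun z => ?_
  simp [zeroOneLoss, labelVal_neg, Set.indicator, margin]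

lemma swapRisk_eq (P : ProbabilityMeasure (Data d)) (ω : EuclideanSpace ℝ (Fin d)) :
    swapRisk P ω = min ((P : Measure (Data d)).map (margin ω) (Set.Iic 0))
      ((P : Measure (Data d)).map (margin ω) (Set.Ici 0)) := by
  rw [swapRisk, lintegral_zeroOneLoss, lintegral_zeroOneLoss_neg]

lemma swapRisk_le_risk (P : ProbabilityMeasure (Data d)) (ω : EuclideanSpace ℝ (Fin d)) :
    swapRisk P ω ≤ risk P ω :=
  min_le_left _ _

lemma swapRisk_neg (P : ProbabilityMeasure (Data d)) (ω : EuclideanSpace ℝ (Fin d)) :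
    swapRisk P (-ω) = swapRisk P ω := by
  rw [swapRisk, swapRisk, min_comm]
  simp [zeroOneLoss, labelVal_neg]

/-! ### Upper bound for the constrained compatibility -/

/-- The mean absolute margin is Lipschitz for the Wasserstein distance. -/
lemma lintegral_abs_margin_le (lam : ℝ≥0) (P Q : ProbabilityMeasure (Data d))
    (ω : EuclideanSpace ℝ (Fin d)) (hω : ‖ω‖ = 1) :
    ∫⁻ z, ENNReal.ofReal |margin ω z| ∂(Q : Measure (Data d)) ≤
      ∫⁻ z, ENNReal.ofReal |margin ω z| ∂(P : Measure (Data d)) + wasserstein lam P Q := by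
  have hm : Measurable fun z : Data d => ENNReal.ofReal |margin ω z| := by
    have := measurable_margin ω
    fun_prop
  rw [← tsub_le_iff_left]
  refine le_iInf₂ fun π hπ => ?_
  rw [tsub_le_iff_left, ← hπ.1, ← hπ.2, Measure.fst, Measure.snd,
    lintegral_map hm measurable_fst, lintegral_map hm measurable_snd,
    ← lintegral_add_left (f := fun w : Data d × Data d => ENNReal.ofReal |margin ω w.1|)
      (hm.comp measurable_fst)]
  refine lintegral_mono fun w => ?_
  refine le_trans ?_ (add_le_add_right (le_add_of_nonneg_right (zero_le)) _)
  rw [← ENNReal.ofReal_add (abs_nonneg _) (norm_nonneg _)]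
  refine ENNReal.ofReal_le_ofReal ?_
  rw [abs_margin, abs_margin]
  have h := abs_real_inner_le_norm ω (w.1.1 - w.2.1)
  rw [hω, one_mul, inner_sub_right] at h
  linarith [abs_sub_abs_le_abs_sub (inner ℝ ω w.2.1) (inner ℝ ω w.1.1),
    abs_sub_comm (inner ℝ ω w.2.1) (inner ℝ ω w.1.1)]

lemma lintegral_abs_margin_gaussianModel (μ ω : EuclideanSpace ℝ (Fin d)) (hω : ‖ω‖ = 1) (σ : ℝ) :
    ∫⁻ z, ENNReal.ofReal |margin ω z| ∂(gaussianModel σ μ) =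
      ENNReal.ofReal (∫ x, |x| ∂gaussianReal (inner ℝ ω μ) (σ ^ 2).toNNReal) := by
  have hi : Integrable (fun x : ℝ => |x|) (gaussianReal (inner ℝ ω μ) (σ ^ 2).toNNReal) :=
    ((memLp_id_gaussianReal 1).integrable (by simp)).abs
  rw [ofReal_integral_eq_lintegral_ofReal hi (ae_of_all _ fun x => abs_nonneg x),
    ← map_margin_gaussianModel μ ω hω σ, lintegral_map (by fun_prop) (measurable_margin ω)]

/-- If L² ≤ 3σ², the trivial bound 1/2 suffices because exp(-1/6) ≥ 5/6. Otherwise a² ≥ 4L²/9 - σ² ≥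
L²/9, and the Chernoff bound on the side opposite to the mean applies. -/
lemma min_gaussianReal_real_le_exp {a L σ : ℝ} (hσ : 0 < σ) (hL : 0 < L)
    (h : L ≤ √(a ^ 2 + σ ^ 2) + L / 3) :
    min ((gaussianReal a (σ ^ 2).toNNReal).real (Set.Iic 0))
      ((gaussianReal a (σ ^ 2).toNNReal).real (Set.Ici 0)) ≤
      Real.exp (-L ^ 2 / (18 * σ ^ 2)) := by
  have hσ2 : 0 < σ ^ 2 := by positivity
  rcases le_or_gt (L ^ 2) (3 * σ ^ 2) with hc | hc
  · refine (min_gaussianReal_real_Iic_Ici_le_half a (by positivity)).trans ?_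
    have h1 : -(1 / 6) ≤ -L ^ 2 / (18 * σ ^ 2) := by
      rw [le_div_iff₀ (by positivity)]
      linarith
    linarith [Real.add_one_le_exp (-L ^ 2 / (18 * σ ^ 2))]
  · have h2 : (2 / 3 * L) ^ 2 ≤ a ^ 2 + σ ^ 2 := by
      rw [← Real.le_sqrt (by positivity) (by positivity)]
      linarith
    have h3 : Real.exp (-a ^ 2 / (2 * (σ ^ 2).toNNReal)) ≤ Real.exp (-L ^ 2 / (18 * σ ^ 2)) := by
      rw [Real.coe_toNNReal _ hσ2.le]
      refine Real.exp_le_exp.mpr ?_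
      rw [div_le_div_iff₀ (by positivity) (by positivity)]
      nlinarith
    rcases le_total 0 a with ha | ha
    · exact min_le_of_left_le ((gaussianReal_real_Iic_le ha _).trans h3)
    · exact min_le_of_right_le ((gaussianReal_real_Ici_le ha _).trans h3)

theorem constrainedCompatibility_swapRisk_le {L σ η : ℝ} (lam : ℝ≥0) (hL : 0 < L) (hσ : 0 < σ)
    (hη : η ≤ L / 3) :
    constrainedCompatibility (d := d) swapRisk lam σ L η ≤
      ENNReal.ofReal (Real.exp (-L ^ 2 / (18 * σ ^ 2))) := by
  refine iSup₂_le fun P₀ ⟨μ₀, hμ₀, hP₀⟩ => ?_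
  have hμ₀' : 0 < ‖μ₀‖ := hL.trans_le hμ₀
  have hω : ‖‖μ₀‖⁻¹ • μ₀‖ = 1 := by
    rw [norm_smul, norm_inv, norm_norm, inv_mul_cancel₀ hμ₀'.ne']
  refine iInf₂_le_of_le (‖μ₀‖⁻¹ • μ₀) (by simpa using hω) (iSup₂_le ?_)
  rintro P ⟨⟨μ, -, hP⟩, hW⟩
  set ω := ‖μ₀‖⁻¹ • μ₀ with hωdef
  have hin : inner ℝ ω μ₀ = ‖μ₀‖ := by
    rw [hωdef, real_inner_smul_left, real_inner_self_eq_norm_sq]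
    field_simp
  have h := (lintegral_abs_margin_le lam P P₀ ω hω).trans (add_le_add_right hW _)
  rw [hP, hP₀, lintegral_abs_margin_gaussianModel _ _ hω,
    lintegral_abs_margin_gaussianModel _ _ hω, hin] at h
  set a := inner ℝ ω μ
  have hle : L ≤ √(a ^ 2 + σ ^ 2) + L / 3 := by
    have h1 := integral_abs_gaussianReal_le a (σ ^ 2).toNNReal
    rw [Real.coe_toNNReal _ (sq_nonneg σ)] at h1
    have h2 := hμ₀.trans (le_integral_abs_gaussianReal ‖μ₀‖ (σ ^ 2).toNNReal)
    rw [← ENNReal.ofReal_le_ofReal_iff (by positivity),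
      ENNReal.ofReal_add (by positivity) (by positivity)]
    calc _ ≤ _ := ENNReal.ofReal_le_ofReal h2
      _ ≤ _ := h
      _ ≤ _ := by gcongr
  rw [swapRisk_eq, hP, map_margin_gaussianModel μ ω hω, ← ofReal_measureReal,
    ← ofReal_measureReal, ← ENNReal.ofReal_min]
  exact ENNReal.ofReal_le_ofReal (min_gaussianReal_real_le_exp hσ hL hle)

/-! ### Lower bound for the unconstrained compatibility -/

open Classical in
/-- Move the points whose margin lies in `(0, t]` orthogonally onto the decision boundary. -/
noncomputable def pushToBoundary (ω : EuclideanSpace ℝ (Fin d)) (t : ℝ) (z : Data d) : Data d :=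
  (if margin ω z ∈ Set.Ioc 0 t then z.1 - inner ℝ ω z.1 • ω else z.1, z.2)

lemma measurable_pushToBoundary (ω : EuclideanSpace ℝ (Fin d)) (t : ℝ) :
    Measurable (pushToBoundary ω t) := by
  refine Measurable.prodMk (Measurable.ite (measurable_margin ω measurableSet_Ioc) ?_ measurable_fst)
    measurable_snd
  have : Measurable fun z : Data d => inner ℝ ω z.1 :=
    (innerSL ℝ ω).continuous.measurable.comp measurable_fst
  exact measurable_fst.sub (this.smul_const ω)

lemma margin_pushToBoundary_of_mem {ω : EuclideanSpace ℝ (Fin d)} (hω : ‖ω‖ = 1) {t : ℝ}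
    {z : Data d} (hz : margin ω z ∈ Set.Ioc 0 t) : margin ω (pushToBoundary ω t z) = 0 := by
  rw [margin, pushToBoundary, if_pos hz, inner_sub_right, real_inner_smul_right,
    real_inner_self_eq_norm_sq, hω]
  ring

lemma margin_pushToBoundary_of_notMem {ω : EuclideanSpace ℝ (Fin d)} {t : ℝ}
    {z : Data d} (hz : margin ω z ∉ Set.Ioc 0 t) :
    margin ω (pushToBoundary ω t z) = margin ω z := by
  rw [margin, pushToBoundary, if_neg hz, margin]

lemma margin_pushToBoundary_nonpos_iff {ω : EuclideanSpace ℝ (Fin d)} (hω : ‖ω‖ = 1) {t : ℝ}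
    (ht : 0 ≤ t) (z : Data d) : margin ω (pushToBoundary ω t z) ≤ 0 ↔ margin ω z ≤ t := by
  by_cases hz : margin ω z ∈ Set.Ioc 0 t
  · simpa [margin_pushToBoundary_of_mem hω hz] using hz.2
  · rw [margin_pushToBoundary_of_notMem hz]
    exact ⟨fun h => h.trans ht, fun h => not_lt.mp fun h' => hz ⟨h', h⟩⟩

lemma margin_pushToBoundary_nonneg_iff {ω : EuclideanSpace ℝ (Fin d)} (hω : ‖ω‖ = 1) (t : ℝ)
    (z : Data d) : 0 ≤ margin ω (pushToBoundary ω t z) ↔ 0 ≤ margin ω z := by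
  by_cases hz : margin ω z ∈ Set.Ioc 0 t
  · simpa [margin_pushToBoundary_of_mem hω hz] using hz.1.le
  · rw [margin_pushToBoundary_of_notMem hz]

lemma transportCost_pushToBoundary_le (lam : ℝ≥0) {ω : EuclideanSpace ℝ (Fin d)} (hω : ‖ω‖ = 1)
    (t : ℝ) (z : Data d) :
    transportCost lam (pushToBoundary ω t z) z ≤
      (margin ω ⁻¹' Set.Ioc 0 t).indicator (fun _ => ENNReal.ofReal t) z := by
  by_cases hz : margin ω z ∈ Set.Ioc 0 t
  · rw [Set.indicator_of_mem (by exact hz)]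
    have hc : ‖(pushToBoundary ω t z).1 - z.1‖ ≤ t := by
      rw [pushToBoundary, if_pos hz, sub_sub_cancel_left, norm_neg, norm_smul, hω, mul_one,
        Real.norm_eq_abs, ← abs_margin, abs_of_pos hz.1]
      exact hz.2
    simpa [transportCost, pushToBoundary] using ENNReal.ofReal_le_ofReal hc
  · simp [transportCost, pushToBoundary, hz]

lemma wasserstein_pushToBoundary_le (lam : ℝ≥0) (P P₀ : ProbabilityMeasure (Data d))
    {ω : EuclideanSpace ℝ (Fin d)} (hω : ‖ω‖ = 1) (t : ℝ)
    (hP : (P : Measure (Data d)) = (P₀ : Measure (Data d)).map (pushToBoundary ω t)) :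
    wasserstein lam P P₀ ≤
      ENNReal.ofReal t * (P₀ : Measure (Data d)).map (margin ω) (Set.Ioc 0 t) := by
  have hm := measurable_pushToBoundary ω t
  have hm' : Measurable fun z => (pushToBoundary ω t z, z) := hm.prodMk measurable_id
  refine iInf₂_le_of_le ((P₀ : Measure (Data d)).map fun z => (pushToBoundary ω t z, z))
    ⟨?_, ?_⟩ ?_
  · rw [hP, Measure.fst, Measure.map_map measurable_fst hm']
    rfl
  · rw [Measure.snd, Measure.map_map measurable_snd hm']
    exact Measure.map_id
  · refine (lintegral_map_le _ _).trans ?_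
    refine (lintegral_mono fun z => transportCost_pushToBoundary_le lam hω t z).trans ?_
    rw [lintegral_indicator_const (measurable_margin ω measurableSet_Ioc),
      Measure.map_apply (measurable_margin ω) measurableSet_Ioc]

/-- Around a Gaussian model there is a distribution within Wasserstein distance `η` on which the
classifier `ω` errs often, even after swapping the labels. -/
lemma exists_le_swapRisk_of_inner_nonneg {L σ η : ℝ} (lam : ℝ≥0) (hσ : 0 < σ) (hη : 0 ≤ η)
    (P₀ : ProbabilityMeasure (Data d)) (μ : EuclideanSpace ℝ (Fin d)) (hμ : ‖μ‖ = L)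
    (hP₀ : (P₀ : Measure (Data d)) = gaussianModel σ μ) (ω : EuclideanSpace ℝ (Fin d))
    (hω : ‖ω‖ = 1) (ha : 0 ≤ inner ℝ ω μ) :
    ∃ P ∈ restrictedBall lam Set.univ η P₀,
      ENNReal.ofReal (Real.exp (-(3 / 2)) / √(2 * Real.pi) *
        min 1 (σ / (σ + L) * Real.exp (-L ^ 2 / (2 * σ ^ 2)) +
          √(η / σ * Real.exp (-L ^ 2 / (2 * σ ^ 2))))) ≤ swapRisk P ω := by
  have haL : inner ℝ ω μ ≤ L := by simpa [hω, hμ] using real_inner_le_norm ω μ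
  obtain ⟨t, ht, hcost, hmass⟩ := exists_threshold ha haL hσ hη
  have hm := measurable_pushToBoundary ω t
  have hlaw := map_margin_gaussianModel μ ω hω σ
  rw [← hP₀] at hlaw
  obtain ⟨P, hP⟩ : ∃ P : ProbabilityMeasure (Data d),
      (P : Measure (Data d)) = (P₀ : Measure (Data d)).map (pushToBoundary ω t) :=
    ⟨⟨_, Measure.isProbabilityMeasure_map hm.aemeasurable⟩, rfl⟩
  refine ⟨P, ⟨trivial, ?_⟩, ?_⟩
  · refine (wasserstein_pushToBoundary_le lam P P₀ hω t hP).trans ?_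
    rw [hlaw, ← ofReal_measureReal, ← ENNReal.ofReal_mul ht]
    exact ENNReal.ofReal_le_ofReal hcost
  · rw [swapRisk_eq, hP, Measure.map_map (measurable_margin ω) hm,
      Measure.map_apply ((measurable_margin ω).comp hm) measurableSet_Iic,
      Measure.map_apply ((measurable_margin ω).comp hm) measurableSet_Ici]
    have e1 : margin ω ∘ pushToBoundary ω t ⁻¹' Set.Iic 0 = margin ω ⁻¹' Set.Iic t :=
      Set.ext fun z => margin_pushToBoundary_nonpos_iff hω ht z
    have e2 : margin ω ∘ pushToBoundary ω t ⁻¹' Set.Ici 0 = margin ω ⁻¹' Set.Ici 0 :=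
      Set.ext fun z => margin_pushToBoundary_nonneg_iff hω t z
    rw [e1, e2, ← Measure.map_apply (measurable_margin ω) measurableSet_Iic,
      ← Measure.map_apply (measurable_margin ω) measurableSet_Ici, hlaw]
    refine le_min ?_ ?_
    · rw [← ofReal_measureReal]
      exact ENNReal.ofReal_le_ofReal hmass
    -- For swapped labels the errors are the original margins in [0, ∞), of mass at least 1/2 since
    -- the mean is nonnegative; the prefactor is at most 1/2.
    · rw [← ofReal_measureReal]
      refine ENNReal.ofReal_le_ofReal ?_
      have hpi : 2 ≤ √(2 * Real.pi) := by
        apply Real.le_sqrt_of_sq_le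
        nlinarith [Real.pi_gt_three]
      have hexp : Real.exp (-(3 / 2)) ≤ 1 := Real.exp_le_one_iff.mpr (by norm_num)
      calc _ ≤ Real.exp (-(3 / 2)) / √(2 * Real.pi) * 1 := by gcongr; exact min_le_left _ _
        _ ≤ 1 / 2 * 1 := by gcongr
        _ ≤ (gaussianReal (inner ℝ ω μ) (σ ^ 2).toNNReal).real (Set.Ici (inner ℝ ω μ)) := by
          rw [mul_one]
          exact (half_le_gaussianReal_real_Iic_Ici _ _).2
        _ ≤ _ := measureReal_mono (Set.Ici_subset_Ici.mpr ha)

lemma exists_le_swapRisk {L σ η : ℝ} (lam : ℝ≥0) (hσ : 0 < σ) (hη : 0 ≤ η)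
    (P₀ : ProbabilityMeasure (Data d)) (μ : EuclideanSpace ℝ (Fin d)) (hμ : ‖μ‖ = L)
    (hP₀ : (P₀ : Measure (Data d)) = gaussianModel σ μ) (ω : EuclideanSpace ℝ (Fin d))
    (hω : ‖ω‖ = 1) :
    ∃ P ∈ restrictedBall lam Set.univ η P₀,
      ENNReal.ofReal (Real.exp (-(3 / 2)) / √(2 * Real.pi) *
        min 1 (σ / (σ + L) * Real.exp (-L ^ 2 / (2 * σ ^ 2)) +
          √(η / σ * Real.exp (-L ^ 2 / (2 * σ ^ 2))))) ≤ swapRisk P ω := by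
  rcases le_total 0 (inner ℝ ω μ) with ha | ha
  · exact exists_le_swapRisk_of_inner_nonneg lam hσ hη P₀ μ hμ hP₀ ω hω ha
  · simpa only [swapRisk_neg] using exists_le_swapRisk_of_inner_nonneg lam hσ hη P₀ μ hμ hP₀ (-ω)
      (by rwa [norm_neg]) (by rw [inner_neg_left]; linarith)

theorem le_unconstrainedCompatibility {L σ η : ℝ} (lam : ℝ≥0) (hd : 1 ≤ d) (hL : 0 < L)
    (hσ : 0 < σ) (hη : 0 ≤ η)
    {R : ProbabilityMeasure (Data d) → EuclideanSpace ℝ (Fin d) → ℝ≥0∞}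
    (hR : ∀ P ω, swapRisk P ω ≤ R P ω) :
    ENNReal.ofReal (Real.exp (-(3 / 2)) / √(2 * Real.pi) *
        min 1 (σ / (σ + L) * Real.exp (-L ^ 2 / (2 * σ ^ 2)) +
          √(η / σ * Real.exp (-L ^ 2 / (2 * σ ^ 2))))) ≤
      unconstrainedCompatibility (d := d) R lam σ L η := by
  obtain ⟨μ, hμ⟩ : ∃ μ : EuclideanSpace ℝ (Fin d), ‖μ‖ = L :=
    ⟨EuclideanSpace.single ⟨0, hd⟩ L, by simp [abs_of_pos hL]⟩
  let P₀ : ProbabilityMeasure (Data d) := ⟨gaussianModel σ μ, inferInstance⟩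
  refine le_iSup₂_of_le P₀ ⟨μ, hμ.ge, rfl⟩ (le_iInf₂ fun ω hω => ?_)
  obtain ⟨P, hP, h⟩ := exists_le_swapRisk lam hσ hη P₀ μ hμ rfl ω (by simpa using hω)
  exact le_iSup₂_of_le P hP (h.trans (hR P ω))

lemma swapRisk_le_of_mem {R : ProbabilityMeasure (Data d) → EuclideanSpace ℝ (Fin d) → ℝ≥0∞}
    (hR : R ∈ ({risk, swapRisk} : Set (_ → _ → ℝ≥0∞))) (P : ProbabilityMeasure (Data d))
    (ω : EuclideanSpace ℝ (Fin d)) : swapRisk P ω ≤ R P ω := by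
  rcases hR with rfl | rfl
  · exact swapRisk_le_risk P ω
  · exact le_rfl

end GDA

theorem mainTheorem3 :
    (∀ (d : ℕ) (L σ : ℝ) (lam : ℝ≥0), 1 ≤ d → 0 < L → 0 < σ → ∀ η ∈ Set.Icc 0 (L / 3),
      GDA.constrainedCompatibility (d := d) GDA.swapRisk lam σ L η ≤
        ENNReal.ofReal (Real.exp (-L ^ 2 / (18 * σ ^ 2)))) ∧
    (∃ c : ℝ, 0 < c ∧ ∀ (d : ℕ) (L σ : ℝ) (lam : ℝ≥0), 1 ≤ d → 0 < L → 0 < σ →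
      ∀ η : ℝ, 0 ≤ η → ∀ R ∈ ({GDA.risk, GDA.swapRisk} : Set (_ → _ → ℝ≥0∞)),
        ENNReal.ofReal (c * min 1 (σ / (σ + L) * Real.exp (-L ^ 2 / (2 * σ ^ 2)) +
          √(η / σ * Real.exp (-L ^ 2 / (2 * σ ^ 2))))) ≤
        GDA.unconstrainedCompatibility (d := d) R lam σ L η) ∧
    (∀ L σ : ℝ, 0 < L → 0 < σ → ∃ c : ℝ, 0 < c ∧ ∀ (d : ℕ) (lam : ℝ≥0), 1 ≤ d →
      ∀ η : ℝ, 0 ≤ η → ∀ R ∈ ({GDA.risk, GDA.swapRisk} : Set (_ → _ → ℝ≥0∞)),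
        ENNReal.ofReal (c * min 1 (Real.exp (-L ^ 2 / (2 * σ ^ 2)) +
          √(η * Real.exp (-L ^ 2 / (2 * σ ^ 2))))) ≤
        GDA.unconstrainedCompatibility (d := d) R lam σ L η) := by
  refine ⟨fun d L σ lam _ hL hσ η hη => GDA.constrainedCompatibility_swapRisk_le lam hL hσ hη.2,
    ⟨Real.exp (-(3 / 2)) / √(2 * Real.pi), by positivity, fun d L σ lam hd hL hσ η hη R hR =>
      GDA.le_unconstrainedCompatibility lam hd hL hσ hη (GDA.swapRisk_le_of_mem hR)⟩,
    fun L σ hL hσ => ?_⟩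
  -- This factor absorbs the prefactor σ/(σ + L) of the Mills term and the 1/√σ from the square
  -- root; the 1 keeps the cap in the minimum.
  have hm : 0 < min 1 (min (σ / (σ + L)) (√σ)⁻¹) := by positivity
  refine ⟨Real.exp (-(3 / 2)) / √(2 * Real.pi) * min 1 (min (σ / (σ + L)) (√σ)⁻¹), by positivity,
    fun d lam hd η hη R hR => (ENNReal.ofReal_le_ofReal ?_).trans
      (GDA.le_unconstrainedCompatibility lam hd hL hσ hη (GDA.swapRisk_le_of_mem hR))⟩
  set m := min 1 (min (σ / (σ + L)) (√σ)⁻¹) with hmdef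
  have hm1 : m ≤ 1 := min_le_left _ _
  have hm2 : m ≤ σ / (σ + L) := (min_le_right _ _).trans (min_le_left _ _)
  have hm3 : m ≤ (√σ)⁻¹ := (min_le_right _ _).trans (min_le_right _ _)
  set e := Real.exp (-L ^ 2 / (2 * σ ^ 2))
  have he : 0 < e := Real.exp_pos _
  have hs : √(η / σ * e) = (√σ)⁻¹ * √(η * e) := by
    rw [← Real.sqrt_inv, ← Real.sqrt_mul (by positivity)]
    congr 1
    ring
  rw [mul_assoc]
  refine mul_le_mul_of_nonneg_left ?_ (by positivity)
  rw [mul_min_of_nonneg _ _ hm.le, mul_one, mul_add, hs]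
  exact min_le_min hm1 (by gcongr)
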